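/- **Definitions.** Let $R=\bigcup_{s\ge1}R_s$ with $R_s\subseteq \mathrm{Her}_s(\mathbb C)^m$ be a matrix convex set, i.e. $\sum_{k=1}^r v_k^*a^{(k)}v_k\in R_t$ (entrywise compressions) whenever $a^{(k)}\in R_{s_k}$, $v_k\in\mathrm{Mat}_{s_k,t}(\mathbb C)$ and $\sum_k v_k^*v_k=I_t$ (all $r,s_k,t\ge1$). For tuples $a$ of $s\times s$ matrices and $b$ of $t\times t$ matrices, say that $a$ *dilates to* $b$ if there is $v\in\mathrm{Mat}_{t,s}(\mathbb C)$ with $v^*v=I_s$ and $a_i=v^*b_iv$ for all $i$. Say that $a$ is a *direct summand of* $b$ *up to simultaneous unitary conjugation* if there are a unitary $u\in\mathrm{Mat}_t(\mathbb C)$ and a tuple $c$ of $(t-s)\times(t-s)$ matrices, $t\ge s$, with $$u^*b_iu=\begin{pmatrix}a_i&0\\0&c_i\end{pmatrix}\quad\text{for all }i .$$ * $a\in R_s$ is an *Arveson extreme point* of $R$ if for all $t\ge1$ and $b\in R_t$ such that $a$ dilates to $b$, $a$ is a direct summand of $b$ up to simultaneous unitary conjugation. * $a\in R_s$ is an *absolute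 extreme point* of $R$ if whenever $a=\sum_{k=1}^r v_k^*b^{(k)}v_k$ with $b^{(k)}\in R_{t_k}$, $t_k\ge1$, $v_k\in \mathrm{Mat}_{t_k,s}(\mathbb C)$, all $v_k\neq0$ and $\sum_kv_k^*v_k=I_s$, then for every $k$, $a$ is a direct summand of $b^{(k)}$ up to simultaneous unitary conjugation (for $t_k=s$ this means that $a$ and $b^{(k)}$ are unitarily equivalent). For $n,s\ge1$ let $\mathcal M^{(n)}_s$ be the set of *quantum magic squares*, i.e. of all $A=(a_{ij})_{i,j=1}^n$ with positive semidefinite $a_{ij}\in\mathrm{Mat}_s(\mathbb C)$ such that every row and every column of $A$ sums to $I_s$, and let $\mathcal P^{(n)}_s\subseteq\mathcal M^{(n)}_s$ be the set of *quantum permutation matrices*, i.e. those with $a_{ij}^2=a_{ij}$ for all $i,j$. Put $\mathcal M^{(n)}=\bigcup_{s\ge1}\mathcal M_s^{(n)}$ (a matrix convex set of $n^2$-tuples) and $\mathcal P^{(n)}=\bigcup_{s\ge1}\mathcal P_s^{(n)}$. **Corollary.** Let $n\ge1$. Every quantum permutation matrix in $\mathcal P^{(n)}$ is an Arveson extreme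 point of the matrix convex set $\mathcal M^{(n)}$. If $n\ge3$, then there exists an Arveson extreme point of $\mathcal M^{(n)}$ that is not a quantum permutation matrix, and there even exists an absolute extreme point of $\mathcal M^{(n)}$ that is not a quantum permutation matrix. -/

import Mathlib

open scoped Matrix ComplexOrder

/-- A tuple, indexed by `ι`, of complex matrices of size `s × s`. -/
abbrev MatTuple (ι : Type) (s : ℕ) : Type := ι → Matrix (Fin s) (Fin s) ℂ

/-- A matrix convex set `R = ⋃_{s ≥ 1} R_s` of tuples of Hermitian matrices: a graded family
`R_s = carrier s` which is closed under all matrix convex combinations `∑ₖ vₖ* a⁽ᵏ⁾ vₖ` with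
`∑ₖ vₖ* vₖ = I_t`. Only the levels `s ≥ 1` are relevant. -/
structure MatrixConvexSet (ι : Type) where
  carrier : (s : ℕ) → Set (MatTuple ι s)
  isHermitian' : ∀ s : ℕ, 1 ≤ s → ∀ a ∈ carrier s, ∀ i, (a i).IsHermitian
  convex' : ∀ (r : ℕ) (σ : Fin r → ℕ) (t : ℕ), 1 ≤ r → (∀ k, 1 ≤ σ k) → 1 ≤ t →
    ∀ (a : ∀ k, MatTuple ι (σ k)) (v : ∀ k, Matrix (Fin (σ k)) (Fin t) ℂ),
      (∀ k, a k ∈ carrier (σ k)) → ∑ k, (v k)ᴴ * v k = 1 →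
        (fun i => ∑ k, (v k)ᴴ * a k i * v k) ∈ carrier t

/-- `a` dilates to `b`: there is an isometry `v` with `aᵢ = v* bᵢ v` for all `i`. -/
def DilatesTo {ι : Type} {s t : ℕ} (a : MatTuple ι s) (b : MatTuple ι t) : Prop :=
  ∃ v : Matrix (Fin t) (Fin s) ℂ, vᴴ * v = 1 ∧ ∀ i, a i = vᴴ * b i * v

/-- The `aᵢ` are direct summands of the `bᵢ` up to a simultaneous unitary conjugation: there are
a unitary `u : ℂˢ ⊕ ℂʳ → ℂᵗ` (so `t = s + r`) and a tuple `c` of `r × r` matrices with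
`u* bᵢ u = aᵢ ⊕ cᵢ` for all `i`. For `r = 0` this says that `a` and `b` are unitarily
equivalent. -/
def IsDirectSummandOf {ι : Type} {s t : ℕ} (a : MatTuple ι s) (b : MatTuple ι t) : Prop :=
  ∃ (r : ℕ) (c : MatTuple ι r) (u : Matrix (Fin t) (Fin s ⊕ Fin r) ℂ),
    uᴴ * u = 1 ∧ u * uᴴ = 1 ∧ ∀ i, uᴴ * b i * u = Matrix.fromBlocks (a i) 0 0 (c i)

/-- Arveson extreme points: every dilation inside `R` is trivial. -/
def IsArvesonExtreme {ι : Type} (R : MatrixConvexSet ι) {s : ℕ} (a : MatTuple ι s) : Prop :=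
  a ∈ R.carrier s ∧
    ∀ t : ℕ, 1 ≤ t → ∀ b ∈ R.carrier t, DilatesTo a b → IsDirectSummandOf a b

/-- Absolute extreme points: whenever `a` is a matrix convex combination `∑ₖ vₖ* b⁽ᵏ⁾ vₖ` of
points of `R` with all `vₖ ≠ 0`, each `b⁽ᵏ⁾` is, up to unitary equivalence, either `a` itself or
a direct sum `a ⊕ z` (where `z`, being a compression of `b⁽ᵏ⁾`, automatically lies in `R`). -/
def IsAbsoluteExtreme {ι : Type} (R : MatrixConvexSet ι) {s : ℕ} (a : MatTuple ι s) : Prop :=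
  a ∈ R.carrier s ∧
    ∀ (r : ℕ) (σ : Fin r → ℕ), (∀ k, 1 ≤ σ k) →
      ∀ (b : ∀ k, MatTuple ι (σ k)) (v : ∀ k, Matrix (Fin (σ k)) (Fin s) ℂ),
        (∀ k, b k ∈ R.carrier (σ k)) → (∀ k, v k ≠ 0) → ∑ k, (v k)ᴴ * v k = 1 →
          (∀ i, a i = ∑ k, (v k)ᴴ * b k i * v k) → ∀ k, IsDirectSummandOf a (b k)

/-- An `n × n` array `(a_{ij})` of complex `s × s` matrices, seen as a tuple indexed by pairs, is
a quantum magic square: the entries are positive semidefinite and all rows and columns sum to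
the identity. -/
structure IsQuantumMagicSquare {n s : ℕ} (a : MatTuple (Fin n × Fin n) s) : Prop where
  posSemidef : ∀ i j, (a (i, j)).PosSemidef
  row_sum : ∀ i, ∑ j, a (i, j) = 1
  col_sum : ∀ j, ∑ i, a (i, j) = 1

/-- A quantum permutation matrix: a quantum magic square all of whose entries are projectors. -/
structure IsQuantumPermutationMatrix {n s : ℕ} (a : MatTuple (Fin n × Fin n) s) : Prop
    extends IsQuantumMagicSquare a where
  idem : ∀ i j, a (i, j) * a (i, j) = a (i, j)

/-- The matrix convex set `M⁽ⁿ⁾` of quantum magic squares of size `n`. -/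
def quantumMagicSquares (n : ℕ) : MatrixConvexSet (Fin n × Fin n) where
  carrier s := {a : MatTuple (Fin n × Fin n) s | IsQuantumMagicSquare a}
  isHermitian' := fun _ _ _ ha i => (ha.posSemidef i.1 i.2).isHermitian
  convex' := by
    intro r σ t _ _ _ a v ha hv
    refine ⟨fun i j => ?_, fun i => ?_, fun j => ?_⟩
    · exact Matrix.posSemidef_sum _ fun k _ =>
        ((ha k).posSemidef i j).conjTranspose_mul_mul_same (v k)
    · rw [Finset.sum_comm, ← hv]
      refine Finset.sum_congr rfl fun k _ => ?_
      rw [← Matrix.sum_mul, ← Matrix.mul_sum, (ha k).row_sum i, Matrix.mul_one]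
    · rw [Finset.sum_comm, ← hv]
      refine Finset.sum_congr rfl fun k _ => ?_
      rw [← Matrix.sum_mul, ← Matrix.mul_sum, (ha k).col_sum j, Matrix.mul_one]

/-! Both parts rest on a linear criterion for a quantum magic square `a`: an array of vectors
`βᵢⱼ ∈ ran aᵢⱼ` all of whose rows and columns sum to zero must vanish (`HasNoZeroSumArray`). Such
arrays are, up to scaling, the columns of the off-diagonal blocks that a dilation of `a` within the
quantum magic squares may have, so under the criterion every isometry `v` with `a = v* b v`
intertwines `a` and `b`, and `a` is a direct summand of `b`. The same argument applies to matrix convex combinations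
(`HasNoZeroSumArray.mul_eq_mul`); if moreover only scalars commute with all `aᵢⱼ`, then each
coefficient is a multiple of an isometry and `a` is absolutely extreme
(`HasNoZeroSumArray.isAbsoluteExtreme`).

A quantum permutation matrix satisfies the criterion since the ranges in each row are mutually
orthogonal. For the second part, an explicit irreducible `3 × 3` quantum magic square with rank one
entries in `Mat₂(ℂ)`, not all of them projectors, satisfies it as well
(`magicSquareThree_zero_sum`).
Written as `(r + x, y; y, r - x) / 12`, with `r = |(x, y)|`, rank one real entries form a quantum
magic square if and only if in each row and column the vectors `(x, y)` close up to a triangle of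
perimeter `12`; the example is built from the triangle with sides `3, 4, 5` and the degenerate
triangle with sides `3, 3, 6`. An identity block extends it to all larger sizes. -/

/-! ### Intertwining isometries and direct summands -/

/-- An isometry `v` that intertwines `a` with a Hermitian tuple `b` exhibits `a` as a direct
summand of `b`: its columns extend to an orthonormal basis, and in that basis the `bᵢ` are block
diagonal. -/
theorem isDirectSummandOf_of_isometry {ι : Type} {s t : ℕ} {a : MatTuple ι s} {b : MatTuple ι t}
    (hb : ∀ i, (b i).IsHermitian) {v : Matrix (Fin t) (Fin s) ℂ} (hv : vᴴ * v = 1)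
    (hbv : ∀ i, b i * v = v * a i) : IsDirectSummandOf a b := by
  have hentry : ∀ k l, ∑ x, star (v x k) * v x l = if k = l then 1 else 0 := fun k l => by
    simpa [Matrix.mul_apply, Matrix.one_apply] using congrFun (congrFun hv k) l
  have hon : Orthonormal ℂ (fun k : Fin s => WithLp.toLp 2 fun x : Fin t => v x k) := by
    rw [orthonormal_iff_ite]
    intro k l
    rw [← hentry k l, PiLp.inner_apply]
    exact Finset.sum_congr rfl fun x _ => by simp [mul_comm]
  have hst : s ≤ t := by
    simpa using hon.linearIndependent.fintype_card_le_finrank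
  obtain ⟨r, rfl⟩ := Nat.exists_eq_add_of_le hst
  let f : Fin s ⊕ Fin r → EuclideanSpace ℂ (Fin (s + r)) :=
    Sum.elim (fun k => WithLp.toLp 2 fun x => v x k) 0
  have hf : Orthonormal ℂ ((Set.range Sum.inl).domRestrict f) := by
    have h := hon.comp (fun y : Set.range (Sum.inl : Fin s → Fin s ⊕ Fin r) => y.2.choose)
      (fun y z h => Subtype.ext (by rw [← y.2.choose_spec, ← z.2.choose_spec]; exact congrArg _ h))
    convert h using 1
    ext1 y
    have : f y.1 = f (Sum.inl y.2.choose) := by rw [y.2.choose_spec]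
    exact this
  obtain ⟨e, he⟩ := hf.exists_orthonormalBasis_extension_of_card_eq (by simp)
  let w : Matrix (Fin (s + r)) (Fin r) ℂ := Matrix.of fun x k => e (Sum.inr k) x
  let u : Matrix (Fin (s + r)) (Fin s ⊕ Fin r) ℂ := Matrix.fromCols v w
  have hu_apply : ∀ x k, u x k = e k x := by
    rintro x (k | k)
    · rw [he _ ⟨k, rfl⟩]; rfl
    · rfl
  have huu : uᴴ * u = 1 := by
    ext k l
    have h := orthonormal_iff_ite.1 e.orthonormal k l
    rw [PiLp.inner_apply] at h
    rw [Matrix.one_apply, ← h, Matrix.mul_apply]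
    exact Finset.sum_congr rfl fun x _ => by simp [hu_apply, mul_comm]
  have hvw : vᴴ * w = 0 := by
    have h := huu
    rw [Matrix.conjTranspose_fromCols_eq_fromRows_conjTranspose, Matrix.fromRows_mul_fromCols,
      ← Matrix.fromBlocks_one, Matrix.fromBlocks_inj] at h
    exact h.2.1
  have hwv : wᴴ * v = 0 := by
    simpa using congrArg Matrix.conjTranspose hvw
  have hvb : ∀ i, vᴴ * b i = (a i)ᴴ * vᴴ := fun i => by
    simpa [Matrix.conjTranspose_mul, (hb i).eq] using congrArg Matrix.conjTranspose (hbv i)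
  refine ⟨r, fun i => wᴴ * b i * w, u, huu,
    (Matrix.mul_eq_one_comm_of_equiv finSumFinEquiv).1 huu, fun i => ?_⟩
  rw [Matrix.conjTranspose_fromCols_eq_fromRows_conjTranspose, Matrix.fromRows_mul,
    Matrix.fromRows_mul_fromCols]
  congr 1
  · rw [Matrix.mul_assoc, hbv, ← Matrix.mul_assoc, hv, Matrix.one_mul]
  · rw [hvb, Matrix.mul_assoc, hvw, Matrix.mul_zero]
  · rw [Matrix.mul_assoc, hbv, ← Matrix.mul_assoc, hwv, Matrix.zero_mul]

/-! ### A kernel criterion for extreme points of the quantum magic squares -/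

/-- The linearised form of Arveson extremality: the only array of vectors `βᵢⱼ` in the ranges of
the `aᵢⱼ` whose rows and columns sum to zero is `β = 0`. As `aᵢⱼ` is Hermitian, its range is
expressed as the orthogonal complement of its kernel. -/
def HasNoZeroSumArray {n s : ℕ} (a : MatTuple (Fin n × Fin n) s) : Prop :=
  ∀ β : Fin n → Fin n → Fin s → ℂ,
    (∀ i j x, a (i, j) *ᵥ x = 0 → star x ⬝ᵥ β i j = 0) →
      (∀ i, ∑ j, β i j = 0) → (∀ j, ∑ i, β i j = 0) → ∀ i j, β i j = 0

/-- If `a = ∑ₖ vₖ* b⁽ᵏ⁾ vₖ` in the quantum magic squares and `a` satisfies the kernel criterion,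
then every `vₖ` intertwines `a` with `b⁽ᵏ⁾`. For each vector `z` the array
`(vₖ* b⁽ᵏ⁾ᵢⱼ - aᵢⱼ vₖ*) z` has zero row and column sums, and it lies in the ranges of the `aᵢⱼ`
because `aᵢⱼ x = 0` forces `b⁽ᵏ⁾ᵢⱼ vₖ x = 0`. -/
theorem HasNoZeroSumArray.mul_eq_mul {n s r : ℕ} {a : MatTuple (Fin n × Fin n) s}
    (ha : IsQuantumMagicSquare a) (hK : HasNoZeroSumArray a) {σ : Fin r → ℕ}
    {b : ∀ k, MatTuple (Fin n × Fin n) (σ k)} {v : ∀ k, Matrix (Fin (σ k)) (Fin s) ℂ}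
    (hb : ∀ k, IsQuantumMagicSquare (b k))
    (hab : ∀ i, a i = ∑ k, (v k)ᴴ * b k i * v k) (k : Fin r) (i : Fin n × Fin n) :
    b k i * v k = v k * a i := by
  have key : ∀ i, (v k)ᴴ * b k i = a i * (v k)ᴴ := by
    rintro ⟨i, j⟩
    rw [← sub_eq_zero]
    refine Matrix.ext_of_mulVec_single fun l => ?_
    rw [Matrix.zero_mulVec]
    refine hK (fun i j => ((v k)ᴴ * b k (i, j) - a (i, j) * (v k)ᴴ) *ᵥ Pi.single l 1)
      (fun i j x hx => ?_) (fun i => ?_) (fun j => ?_) i j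
    · have hker : b k (i, j) *ᵥ (v k *ᵥ x) = 0 := by
        have hnonneg : ∀ m ∈ Finset.univ,
            0 ≤ star (v m *ᵥ x) ⬝ᵥ (b m (i, j) *ᵥ (v m *ᵥ x)) :=
          fun m _ => ((hb m).posSemidef i j).dotProduct_mulVec_nonneg _
        have hsum : ∑ m, star (v m *ᵥ x) ⬝ᵥ (b m (i, j) *ᵥ (v m *ᵥ x)) = 0 := by
          have h : star x ⬝ᵥ (a (i, j) *ᵥ x) = 0 := by rw [hx, dotProduct_zero]
          rw [hab, Matrix.sum_mulVec, dotProduct_sum] at h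
          rw [← h]
          refine Finset.sum_congr rfl fun m _ => ?_
          rw [Matrix.star_mulVec, ← Matrix.dotProduct_mulVec, Matrix.mulVec_mulVec,
            Matrix.mulVec_mulVec, Matrix.mul_assoc]
        exact (((hb k).posSemidef i j).dotProduct_mulVec_zero_iff _).1
          ((Finset.sum_eq_zero_iff_of_nonneg hnonneg).1 hsum k (Finset.mem_univ k))
      have hleft : star x ᵥ* ((v k)ᴴ * b k (i, j) - a (i, j) * (v k)ᴴ) = 0 := by
        have h1 : star x ᵥ* ((v k)ᴴ * b k (i, j)) = 0 := by
          have h := congrArg star hker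
          rwa [Matrix.star_mulVec, Matrix.star_mulVec, ((hb k).posSemidef i j).isHermitian.eq,
            Matrix.vecMul_vecMul, star_zero] at h
        have h2 : star x ᵥ* (a (i, j) * (v k)ᴴ) = 0 := by
          have h := congrArg star hx
          rw [Matrix.star_mulVec, (ha.posSemidef i j).isHermitian.eq, star_zero] at h
          rw [← Matrix.vecMul_vecMul, h, Matrix.zero_vecMul]
        rw [Matrix.vecMul_sub, h1, h2, sub_zero]
      rw [Matrix.dotProduct_mulVec, hleft, zero_dotProduct]
    · rw [← Matrix.sum_mulVec, Finset.sum_sub_distrib, ← Matrix.mul_sum, ← Matrix.sum_mul,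
        (hb k).row_sum i, ha.row_sum i, Matrix.mul_one, Matrix.one_mul, sub_self,
        Matrix.zero_mulVec]
    · rw [← Matrix.sum_mulVec, Finset.sum_sub_distrib, ← Matrix.mul_sum, ← Matrix.sum_mul,
        (hb k).col_sum j, ha.col_sum j, Matrix.mul_one, Matrix.one_mul, sub_self,
        Matrix.zero_mulVec]
  simpa [Matrix.conjTranspose_mul, ((hb k).posSemidef i.1 i.2).isHermitian.eq,
    (ha.posSemidef i.1 i.2).isHermitian.eq] using congrArg Matrix.conjTranspose (key i)

theorem HasNoZeroSumArray.isArvesonExtreme {n s : ℕ} {a : MatTuple (Fin n × Fin n) s}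
    (ha : IsQuantumMagicSquare a) (hK : HasNoZeroSumArray a) :
    IsArvesonExtreme (quantumMagicSquares n) a := by
  refine ⟨ha, fun t _ b hb ⟨v, hv, hab⟩ =>
    isDirectSummandOf_of_isometry (fun i => (hb.posSemidef i.1 i.2).isHermitian) hv fun i => ?_⟩
  exact hK.mul_eq_mul ha (r := 1) (σ := fun _ => t) (b := fun _ => b) (v := fun _ => v)
    (fun _ => hb) (fun i => by simpa using hab i) 0 i

/-- The kernel criterion and irreducibility together give absolute extremality: the `vₖ* vₖ`
commute with all `aᵢⱼ`, so each `vₖ` is a positive multiple of an intertwining isometry. -/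
theorem HasNoZeroSumArray.isAbsoluteExtreme {n s : ℕ} {a : MatTuple (Fin n × Fin n) s}
    (ha : IsQuantumMagicSquare a) (hK : HasNoZeroSumArray a)
    (hirr : ∀ x : Matrix (Fin s) (Fin s) ℂ, (∀ i, x * a i = a i * x) → ∃ c : ℂ, x = c • 1) :
    IsAbsoluteExtreme (quantumMagicSquares n) a := by
  refine ⟨ha, fun r σ _ b v hb hv0 _ hab k => ?_⟩
  have hint := hK.mul_eq_mul ha hb hab k
  have hint' : ∀ i, (v k)ᴴ * b k i = a i * (v k)ᴴ := fun i => by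
    simpa [Matrix.conjTranspose_mul, ((hb k).posSemidef i.1 i.2).isHermitian.eq,
      (ha.posSemidef i.1 i.2).isHermitian.eq] using congrArg Matrix.conjTranspose (hint i)
  obtain ⟨c, hc⟩ := hirr ((v k)ᴴ * v k) fun i => by
    rw [Matrix.mul_assoc, ← hint i, ← Matrix.mul_assoc, hint' i, Matrix.mul_assoc]
  have hpos : 0 < c := by
    have htr : 0 < ((v k)ᴴ * v k).trace :=
      lt_of_le_of_ne (Matrix.posSemidef_conjTranspose_mul_self _).trace_nonneg
        fun h => hv0 k (Matrix.trace_conjTranspose_mul_self_eq_zero_iff.1 h.symm)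
    rw [hc, Matrix.trace_smul, Matrix.trace_one, Fintype.card_fin, smul_eq_mul] at htr
    exact pos_of_mul_pos_left htr (Nat.cast_nonneg s)
  obtain ⟨d, rfl⟩ : ∃ d : ℝ, (d : ℂ) = c := ⟨c.re, Complex.ext rfl (Complex.pos_iff.1 hpos).2⟩
  have hd : 0 < d := by exact_mod_cast hpos
  refine isDirectSummandOf_of_isometry (v := (((√d)⁻¹ : ℝ) : ℂ) • v k)
    (fun i => ((hb k).posSemidef i.1 i.2).isHermitian) ?_ fun i => ?_
  · rw [Matrix.conjTranspose_smul, Matrix.smul_mul, Matrix.mul_smul, hc, smul_smul, smul_smul]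
    have : (star (((√d)⁻¹ : ℝ) : ℂ)) * (((√d)⁻¹ : ℝ) : ℂ) * (d : ℂ) = 1 := by
      rw [Complex.star_def, Complex.conj_ofReal]
      norm_cast
      rw [← mul_inv, Real.mul_self_sqrt hd.le, inv_mul_cancel₀ hd.ne']
    rw [this, one_smul]
  · rw [Matrix.mul_smul, hint i, Matrix.smul_mul]

/-! ### Quantum permutation matrices -/

/-- Projectors in a common row annihilate each other's ranges, so a row sum can only vanish
termwise. -/
theorem IsQuantumPermutationMatrix.hasNoZeroSumArray {n s : ℕ}
    {a : MatTuple (Fin n × Fin n) s} (ha : IsQuantumPermutationMatrix a) :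
    HasNoZeroSumArray a := by
  intro β hβ hrow _ i j
  have hherm : ∀ k, (a (i, k))ᴴ = a (i, k) := fun k => (ha.posSemidef i k).isHermitian.eq
  have hfix : ∀ k, a (i, k) *ᵥ β i k = β i k := by
    intro k
    have hker : ∀ y, a (i, k) *ᵥ (y - a (i, k) *ᵥ y) = 0 := fun y => by
      rw [Matrix.mulVec_sub, Matrix.mulVec_mulVec, ha.idem, sub_self]
    have hδ := hβ i k (β i k - a (i, k) *ᵥ β i k) (hker _)
    have hself : star (β i k - a (i, k) *ᵥ β i k) ⬝ᵥ (β i k - a (i, k) *ᵥ β i k) = 0 := by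
      have h := congrArg star (hker (β i k))
      rw [Matrix.star_mulVec, hherm, star_zero] at h
      rw [dotProduct_sub, hδ, Matrix.dotProduct_mulVec, h, zero_dotProduct, sub_zero]
    exact (sub_eq_zero.1 (dotProduct_star_self_eq_zero.1 hself)).symm
  have horth : ∀ k, k ≠ j → a (i, j) *ᵥ β i k = 0 := by
    intro k hk
    -- The quadratic forms of the row add up to `‖βᵢₖ‖²`, which the `k`-th one exhausts.
    have hsum : ∑ l, star (β i k) ⬝ᵥ (a (i, l) *ᵥ β i k) = star (β i k) ⬝ᵥ β i k := by
      rw [← dotProduct_sum, ← Matrix.sum_mulVec, ha.row_sum, Matrix.one_mulVec]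
    rw [← Finset.add_sum_erase _ _ (Finset.mem_univ k), hfix, add_eq_left] at hsum
    exact ((ha.posSemidef i j).dotProduct_mulVec_zero_iff _).1
      ((Finset.sum_eq_zero_iff_of_nonneg fun l _ =>
        (ha.posSemidef i l).dotProduct_mulVec_nonneg _).1 hsum j (by simp [hk.symm]))
  have h : a (i, j) *ᵥ ∑ k, β i k = 0 := by rw [hrow i, Matrix.mulVec_zero]
  rw [Matrix.mulVec_sum, Finset.sum_eq_single j (fun k _ hk => horth k hk) (by simp), hfix] at h
  exact h

/-! ### An irreducible quantum magic square with non-projective entries -/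

/-- Vectors spanning the ranges of the entries of `magicSquareThree`. -/
def magicVector : Fin 3 → Fin 3 → Fin 2 → ℂ :=
  ![![![0, 1], ![1, 0], ![1, 0]],
    ![![1, 0], ![1, -2], ![1, 1]],
    ![![1, 0], ![1, 1], ![1, -2]]]

/-- Weights turning the rank one matrices of the `magicVector`s into a quantum magic square. -/
noncomputable def magicWeight : Fin 3 → Fin 3 → ℝ :=
  ![![1, 1 / 2, 1 / 2],
    ![1 / 2, 1 / 6, 1 / 3],
    ![1 / 2, 1 / 3, 1 / 6]]

/-- A quantum magic square of size `3` with entries `wᵢⱼ xᵢⱼ xᵢⱼ*` of rank one in `Mat₂(ℂ)`. -/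
noncomputable def magicSquareThree (i j : Fin 3) : Matrix (Fin 2) (Fin 2) ℂ :=
  (magicWeight i j : ℂ) • Matrix.vecMulVec (magicVector i j) (star (magicVector i j))

theorem star_magicVector (i j : Fin 3) (k : Fin 2) :
    star (magicVector i j k) = magicVector i j k := by
  fin_cases i <;> fin_cases j <;> fin_cases k <;> simp [magicVector]

theorem magicSquareThree_apply (i j : Fin 3) (k l : Fin 2) : magicSquareThree i j k l =
    magicWeight i j * (magicVector i j k * magicVector i j l) := by
  rw [← star_magicVector i j l]; rfl

theorem magicSquareThree_posSemidef (i j : Fin 3) : (magicSquareThree i j).PosSemidef := by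
  refine (Matrix.posSemidef_vecMulVec_self_star _).smul ?_
  have : 0 ≤ magicWeight i j := by
    fin_cases i <;> fin_cases j <;> norm_num [magicWeight]
  exact_mod_cast this

theorem magicSquareThree_row_sum (i : Fin 3) : ∑ j, magicSquareThree i j = 1 := by
  ext k l
  fin_cases i <;> fin_cases k <;> fin_cases l <;>
    simp [Fin.sum_univ_three, magicSquareThree_apply, magicWeight, magicVector] <;> norm_num

theorem magicSquareThree_symm (i j : Fin 3) : magicSquareThree i j = magicSquareThree j i := by
  fin_cases i <;> fin_cases j <;> rfl

theorem magicSquareThree_col_sum (j : Fin 3) : ∑ i, magicSquareThree i j = 1 := by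
  simp_rw [magicSquareThree_symm _ j]
  exact magicSquareThree_row_sum j

/-- The quantum magic square of size `3 + m` that is `magicSquareThree` in the upper left corner
and the identity permutation in the lower right corner. -/
noncomputable def magicSquareExtended (m : ℕ) : MatTuple (Fin (3 + m) × Fin (3 + m)) 2 :=
  fun p => Matrix.fromBlocks (Matrix.of magicSquareThree) 0 0
    (1 : Matrix (Fin m) (Fin m) (Matrix (Fin 2) (Fin 2) ℂ))
    (finSumFinEquiv.symm p.1) (finSumFinEquiv.symm p.2)

theorem magicSquareExtended_apply (m : ℕ) (p q : Fin 3 ⊕ Fin m) :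
    magicSquareExtended m (finSumFinEquiv p, finSumFinEquiv q) =
      Matrix.fromBlocks (Matrix.of magicSquareThree) 0 0 1 p q := by
  simp only [magicSquareExtended, Equiv.symm_apply_apply]

theorem magicSquareExtended_isQuantumMagicSquare (m : ℕ) :
    IsQuantumMagicSquare (magicSquareExtended m) := by
  refine ⟨fun i j => ?_, fun i => ?_, fun j => ?_⟩
  · obtain ⟨p, rfl⟩ := finSumFinEquiv.surjective i
    obtain ⟨q, rfl⟩ := finSumFinEquiv.surjective j
    rw [magicSquareExtended_apply]
    rcases p with p | p <;> rcases q with q | q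
    · exact magicSquareThree_posSemidef p q
    · exact Matrix.PosSemidef.zero
    · exact Matrix.PosSemidef.zero
    · rw [Matrix.fromBlocks_apply₂₂, Matrix.one_apply]
      split_ifs
      · exact Matrix.PosSemidef.one
      · exact Matrix.PosSemidef.zero
  · obtain ⟨p, rfl⟩ := finSumFinEquiv.surjective i
    rw [← finSumFinEquiv.sum_comp]
    simp_rw [magicSquareExtended_apply]
    rcases p with p | p
    · simpa using magicSquareThree_row_sum p
    · simp [Matrix.one_apply]
  · obtain ⟨q, rfl⟩ := finSumFinEquiv.surjective j
    rw [← finSumFinEquiv.sum_comp]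
    simp_rw [magicSquareExtended_apply]
    rcases q with q | q
    · simpa using magicSquareThree_col_sum q
    · simp [Matrix.one_apply]

/-- The kernel criterion for the corner: with `βᵢⱼ` proportional to `magicVector i j`, the zero
row and column sums form a linear system with only the trivial solution. -/
theorem magicSquareThree_zero_sum {β : Fin 3 → Fin 3 → Fin 2 → ℂ}
    (hβ : ∀ i j x, magicSquareThree i j *ᵥ x = 0 → star x ⬝ᵥ β i j = 0)
    (hrow : ∀ i, ∑ j, β i j = 0) (hcol : ∀ j, ∑ i, β i j = 0) (i j : Fin 3) : β i j = 0 := by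
  have hprop : ∀ i j, magicVector i j 0 * β i j 1 = magicVector i j 1 * β i j 0 := by
    intro i j
    have h := hβ i j ![-magicVector i j 1, magicVector i j 0] (by
      ext k
      fin_cases i <;> fin_cases j <;> fin_cases k <;>
        norm_num [magicSquareThree_apply, magicWeight, magicVector, Matrix.mulVec, dotProduct,
          Fin.sum_univ_two])
    simp only [dotProduct, Fin.sum_univ_two, Pi.star_apply] at h
    simp only [Matrix.cons_val_zero, Matrix.cons_val_one, star_neg, star_magicVector] at h
    linear_combination h
  have hr : ∀ i k, β i 0 k + β i 1 k + β i 2 k = 0 := fun i k => by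
    simpa [Fin.sum_univ_three] using congrFun (hrow i) k
  have hc : ∀ j k, β 0 j k + β 1 j k + β 2 j k = 0 := fun j k => by
    simpa [Fin.sum_univ_three] using congrFun (hcol j) k
  have p00 : β 0 0 0 = 0 := by simpa [magicVector, eq_comm] using hprop 0 0
  have p01 : β 0 1 1 = 0 := by simpa [magicVector] using hprop 0 1
  have p02 : β 0 2 1 = 0 := by simpa [magicVector] using hprop 0 2
  have p10 : β 1 0 1 = 0 := by simpa [magicVector] using hprop 1 0
  have p20 : β 2 0 1 = 0 := by simpa [magicVector] using hprop 2 0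
  have p11 : β 1 1 1 = -2 * β 1 1 0 := by simpa [magicVector] using hprop 1 1
  have p12 : β 1 2 1 = β 1 2 0 := by simpa [magicVector] using hprop 1 2
  have p21 : β 2 1 1 = β 2 1 0 := by simpa [magicVector] using hprop 2 1
  have p22 : β 2 2 1 = -2 * β 2 2 0 := by simpa [magicVector] using hprop 2 2
  have q00 : β 0 0 1 = 0 := by linear_combination hr 0 1 - p01 - p02
  have h12 : β 1 2 0 = 2 * β 1 1 0 := by linear_combination hr 1 1 - p10 - p11 - p12
  have h21 : β 2 1 0 = 2 * β 1 1 0 := by linear_combination hc 1 1 - p01 - p11 - p21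
  have h22 : β 2 2 0 = β 1 1 0 := by
    linear_combination (-1 / 2 : ℂ) * (hr 2 1 - p20 - p21 - p22) + (1 / 2 : ℂ) * h21
  have h10 : β 1 0 0 = -3 * β 1 1 0 := by linear_combination hr 1 0 - h12
  have h20 : β 2 0 0 = -3 * β 1 1 0 := by linear_combination hr 2 0 - h21 - h22
  have q11 : β 1 1 0 = 0 := by
    linear_combination (-1 / 6 : ℂ) * (hc 0 0 - p00 - h10 - h20)
  have h01 : β 0 1 0 = 0 := by linear_combination hc 1 0 - h21 - 3 * q11
  have h02 : β 0 2 0 = 0 := by linear_combination hc 2 0 - h12 - h22 - 3 * q11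
  ext k
  fin_cases i <;> fin_cases j <;> fin_cases k <;>
    simp [p00, p01, p02, p10, p20, p11, p12, p21, p22, q00, h12, h21, h22, h10, h20, q11, h01, h02]

theorem magicSquareExtended_hasNoZeroSumArray (m : ℕ) :
    HasNoZeroSumArray (magicSquareExtended m) := by
  intro β hβ hrow hcol
  let γ : Fin 3 ⊕ Fin m → Fin 3 ⊕ Fin m → Fin 2 → ℂ :=
    fun p q => β (finSumFinEquiv p) (finSumFinEquiv q)
  have hγ : ∀ p q x, Matrix.fromBlocks (Matrix.of magicSquareThree) 0 0 1 p q *ᵥ x = 0 →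
      star x ⬝ᵥ γ p q = 0 := fun p q x hx =>
    hβ _ _ x (by rwa [magicSquareExtended_apply])
  have hγrow : ∀ p, ∑ q, γ p q = 0 := fun p => by
    rw [← hrow (finSumFinEquiv p), ← finSumFinEquiv.sum_comp]
  have hγcol : ∀ q, ∑ p, γ p q = 0 := fun q => by
    rw [← hcol (finSumFinEquiv q), ← finSumFinEquiv.sum_comp]
  have hzero : ∀ p q, Matrix.fromBlocks (Matrix.of magicSquareThree) 0 0 1 p q = 0 →
      γ p q = 0 := fun p q h => by
    have h' := hγ p q (γ p q) (by rw [h, Matrix.zero_mulVec])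
    exact dotProduct_star_self_eq_zero.1 h'
  have h12 : ∀ p q, γ (.inl p) (.inr q) = 0 := fun p q => hzero _ _ rfl
  have h21 : ∀ p q, γ (.inr p) (.inl q) = 0 := fun p q => hzero _ _ rfl
  have h22 : ∀ p q, γ (.inr p) (.inr q) = 0 := fun p q => by
    have hoff : ∀ q', p ≠ q' → γ (.inr p) (.inr q') = 0 := fun q' h =>
      hzero _ _ (by rw [Matrix.fromBlocks_apply₂₂, Matrix.one_apply_ne h])
    rcases eq_or_ne p q with rfl | h
    · have h := hγrow (.inr p)
      rwa [Fintype.sum_sum_type, Finset.sum_eq_zero (fun q _ => h21 p q), zero_add,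
        Finset.sum_eq_single p (fun q _ hq => hoff q hq.symm) (by simp)] at h
    · exact hoff q h
  have h11 : ∀ p q, γ (.inl p) (.inl q) = 0 :=
    magicSquareThree_zero_sum (fun p q => hγ (.inl p) (.inl q))
      (fun p => by simpa [h12] using hγrow (.inl p))
      (fun q => by simpa [h21] using hγcol (.inl q))
  intro i j
  obtain ⟨p, rfl⟩ := finSumFinEquiv.surjective i
  obtain ⟨q, rfl⟩ := finSumFinEquiv.surjective j
  rcases p with p | p <;> rcases q with q | q
  exacts [h11 p q, h12 p q, h21 p q, h22 p q]

/-- Commuting with the entry `diag(0, 1)` makes a matrix diagonal, and commuting with a multiple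
of the all-ones matrix makes its diagonal constant. -/
theorem magicSquareExtended_irreducible (m : ℕ) (x : Matrix (Fin 2) (Fin 2) ℂ)
    (hx : ∀ i, x * magicSquareExtended m i = magicSquareExtended m i * x) :
    ∃ c : ℂ, x = c • 1 := by
  have h : ∀ i j, x * magicSquareThree i j = magicSquareThree i j * x := fun i j => by
    have h := hx (finSumFinEquiv (.inl i), finSumFinEquiv (.inl j))
    rwa [magicSquareExtended_apply] at h
  have h1 := congrFun (congrFun (h 0 0) 0) 1
  have h2 := congrFun (congrFun (h 0 0) 1) 0
  have h3 := congrFun (congrFun (h 1 2) 0) 1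
  simp [magicSquareThree_apply, magicWeight, magicVector, Matrix.mul_apply, Fin.sum_univ_two]
    at h1 h2 h3
  refine ⟨x 0 0, ?_⟩
  ext k l
  fin_cases k <;> fin_cases l <;> simp [h1, ← h2]
  linear_combination (-3 : ℂ) * h3

theorem magicSquareExtended_not_isQuantumPermutationMatrix (m : ℕ) :
    ¬ IsQuantumPermutationMatrix (magicSquareExtended m) := by
  intro h
  have h' := h.idem (finSumFinEquiv (.inl 0)) (finSumFinEquiv (.inl 1))
  rw [magicSquareExtended_apply] at h'
  have h00 := congrFun (congrFun h' 0) 0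
  norm_num [magicSquareThree_apply, magicWeight, magicVector, Matrix.mul_apply, Fin.sum_univ_two]
    at h00

theorem corollary3p7 (n : ℕ) (hn : 1 ≤ n) :
    (∀ s : ℕ, 1 ≤ s → ∀ a : MatTuple (Fin n × Fin n) s, IsQuantumPermutationMatrix a →
      IsArvesonExtreme (quantumMagicSquares n) a) ∧
    (3 ≤ n →
      (∃ s : ℕ, 1 ≤ s ∧ ∃ a : MatTuple (Fin n × Fin n) s,
        IsArvesonExtreme (quantumMagicSquares n) a ∧ ¬ IsQuantumPermutationMatrix a) ∧
      (∃ s : ℕ, 1 ≤ s ∧ ∃ a : MatTuple (Fin n × Fin n) s,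
        IsAbsoluteExtreme (quantumMagicSquares n) a ∧ ¬ IsQuantumPermutationMatrix a)) := by
  refine ⟨fun s _ a ha => ha.hasNoZeroSumArray.isArvesonExtreme ha.toIsQuantumMagicSquare,
    fun h3 => ?_⟩
  obtain ⟨m, rfl⟩ := Nat.exists_eq_add_of_le h3
  have hsq := magicSquareExtended_isQuantumMagicSquare m
  have hK := magicSquareExtended_hasNoZeroSumArray m
  have hP := magicSquareExtended_not_isQuantumPermutationMatrix m
  exact ⟨⟨2, one_le_two, _, hK.isArvesonExtreme hsq, hP⟩,
    ⟨2, one_le_two, _, hK.isAbsoluteExtreme hsq (magicSquareExtended_irreducible m), hP⟩⟩
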